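/- Let $a_1,a_2,a_3\in\mathbb R$, let $F,\beta:\mathbb R^3\to(0,\infty)$ and $f:\mathbb R^2\to(0,\infty)$ be smooth, and put $G=F\beta$. Let $\varphi:\mathbb R^2\to\mathbb R^3$, $\varphi(x,y)=(x,y,a_1x+a_2y+a_3)$, let $h_0=F^{-2}(dx^2+dy^2+dz^2)$ and $h=\beta^{-2}h_0$ on $\mathbb R^3$, and consider the map $\varphi:(\mathbb R^2,f^{-1}\varphi^*h)\to(\mathbb R^3,h)$. For a map $\varphi:(M,g)\to(N,h)$ of Riemannian manifolds with tension field $\tau(\varphi)=\operatorname{Trace}_g\nabla d\varphi$, call $\varphi$ proper biharmonic if $\tau(\varphi)\not\equiv0$ and $$\tau_2(\varphi)=\operatorname{Trace}_g(\nabla^\varphi\nabla^\varphi-\nabla^\varphi_{\nabla^M})\tau(\varphi)-\operatorname{Trace}_gR^N(d\varphi,\tau(\varphi))d\varphi\equiv0,$$ where $R^N(X,Y)Z=[\nabla^N_X,\nabla^N_Y]Z-\nabla^N_{[X,Y]}Z$. Then $\varphi:(\mathbb R^2,f^{-1}\varphi^*h)\to(\mathbb R^3,h)$ is proper biharmonic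 if and only if both of the following hold: (1) at every point of the plane $z=a_1x+a_2y+a_3$, $$\begin{aligned} &\tfrac{1+2a_1^2+a_2^2}{1+a_1^2+a_2^2}\,[GG_{xx}-2G_x^2]+\tfrac{1+a_1^2+2a_2^2}{1+a_1^2+a_2^2}\,[GG_{yy}-2G_y^2]+\tfrac{2+a_1^2+a_2^2}{1+a_1^2+a_2^2}\,[GG_{zz}-2G_z^2]\\ &+\tfrac{2a_1a_2}{1+a_1^2+a_2^2}\,[GG_{xy}-2G_xG_y]-\tfrac{2a_1}{1+a_1^2+a_2^2}\,[GG_{xz}-2G_xG_z]-\tfrac{2a_2}{1+a_1^2+a_2^2}\,[GG_{yz}-2G_yG_z]=0; \end{aligned}$$ (2) $-a_1G_x-a_2G_y+G_z$ vanishes nowhere on this plane, and for some constant $c>0$ $$f=\frac{c\,\sqrt{1+a_1^2+a_2^2}}{|-a_1G_x-a_2G_y+G_z|}\circ\varphi .$$ Furthermore, without assuming biharmonicity, $\varphi:(\mathbb R^2,f^{-1}\varphi^*h)\to(\mathbb R^3,h)$ is a conformal immersion with conformal factor $\lambda=f^{1/2}$ (that is, $\varphi^*h=\lambda^2\,f^{-1}\varphi^*h$),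 the field $\xi=\frac{G\circ\varphi}{\sqrt{1+a_1^2+a_2^2}}\,(-a_1,-a_2,1)$ is a unit normal of the surface in $(\mathbb R^3,h)$, and the surface $(\mathbb R^2,\varphi^*h)$ has mean curvature vector field $H\xi$ with $$H=\frac{-a_1G_x-a_2G_y+G_z}{\sqrt{1+a_1^2+a_2^2}}\circ\varphi .$$ -/

import Mathlib

open scoped ContDiff

/-! Riemannian geometry in the global coordinates of `ℝⁿ`, modelled as `Fin n → ℝ`.  A (Riemannian)
metric on `ℝⁿ` is given by the matrix field `g x i j = g(∂ᵢ, ∂ⱼ)(x)`, and a vector field along a map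
`φ : ℝᵐ → ℝⁿ` is given by its components, as a map `ℝᵐ → ℝⁿ`. -/

namespace CoordGeom

noncomputable section

/-- The partial derivative `∂ᵢ f` of a real function on `ℝⁿ`. -/
def pd {n : ℕ} (i : Fin n) (f : (Fin n → ℝ) → ℝ) (x : Fin n → ℝ) : ℝ :=
  fderiv ℝ f x (Pi.single i 1)

/-- A field of matrices on `ℝⁿ`, thought of as a field of bilinear forms. -/
abbrev MetricField (n : ℕ) : Type := (Fin n → ℝ) → Matrix (Fin n) (Fin n) ℝ

/-- The field `g` is a smooth Riemannian metric on `ℝⁿ`. -/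
def IsRiemannianMetric {n : ℕ} (g : MetricField n) : Prop :=
  (∀ i j, ContDiff ℝ ∞ (fun x => g x i j)) ∧ ∀ x, (g x).PosDef

/-- The standard flat metric of `ℝⁿ`. -/
def euclideanMetric (n : ℕ) : MetricField n := fun _ => 1

/-- The pointwise rescaling `u g` of the metric `g` by the function `u`. -/
def rescale {n : ℕ} (u : (Fin n → ℝ) → ℝ) (g : MetricField n) : MetricField n :=
  fun x => u x • g x

/-- The inner product `g_x(v, w)`. -/
def metricInner {n : ℕ} (g : MetricField n) (x v w : Fin n → ℝ) : ℝ :=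
  ∑ i, ∑ j, g x i j * v i * w j

/-- The Christoffel symbol `Γᵏᵢⱼ` of the Levi-Civita connection of `g`. -/
def christoffel {n : ℕ} (g : MetricField n) (k i j : Fin n) (x : Fin n → ℝ) : ℝ :=
  (1 / 2) * ∑ l, (g x)⁻¹ k l *
    (pd i (fun y => g y j l) x + pd j (fun y => g y i l) x - pd l (fun y => g y i j) x)

/-- The component `Rˡ` of `R(∂ᵢ, ∂ⱼ)∂ₖ = Rˡ ∂ₗ`, for the curvature operator
`R(X, Y)Z = ∇_X ∇_Y Z - ∇_Y ∇_X Z - ∇_[X, Y] Z` of `g`. -/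
def curvature {n : ℕ} (g : MetricField n) (i j k l : Fin n) (x : Fin n → ℝ) : ℝ :=
  pd i (christoffel g l j k) x - pd j (christoffel g l i k) x
    + ∑ s, (christoffel g s j k x * christoffel g l i s x
      - christoffel g s i k x * christoffel g l j s x)

/-- The curvature operator `R(X, Y)Z` of `g` at the point `x`. -/
def curvatureOp {n : ℕ} (g : MetricField n) (x X Y Z : Fin n → ℝ) : Fin n → ℝ :=
  fun l => ∑ i, ∑ j, ∑ k, X i * Y j * Z k * curvature g i j k l x

/-- The vector field `dφ(∂ᵢ)` along `φ`. -/
def dmap {m n : ℕ} (φ : (Fin m → ℝ) → (Fin n → ℝ)) (i : Fin m) (x : Fin m → ℝ) : Fin n → ℝ :=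
  fun α => pd i (fun y => φ y α) x

/-- The covariant derivative `∇^φ_{∂ᵢ} V` of a vector field `V` along `φ : ℝᵐ → (ℝⁿ, h)`, for the
connection on `φ⁻¹ T ℝⁿ` pulled back from the Levi-Civita connection of `h`. -/
def covDeriv {m n : ℕ} (h : MetricField n) (φ : (Fin m → ℝ) → (Fin n → ℝ)) (i : Fin m)
    (V : (Fin m → ℝ) → (Fin n → ℝ)) (x : Fin m → ℝ) : Fin n → ℝ :=
  fun α => pd i (fun y => V y α) x
    + ∑ b, ∑ c, christoffel h α b c (φ x) * dmap φ i x b * V x c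

/-- The second fundamental form `(∇dφ)(∂ᵢ, ∂ⱼ)` of a map `φ : (ℝᵐ, g) → (ℝⁿ, h)`. -/
def secondFundForm {m n : ℕ} (g : MetricField m) (h : MetricField n)
    (φ : (Fin m → ℝ) → (Fin n → ℝ)) (i j : Fin m) (x : Fin m → ℝ) : Fin n → ℝ :=
  covDeriv h φ i (dmap φ j) x - ∑ k, christoffel g k i j x • dmap φ k x

/-- The tension field `τ(φ) = Trace_g ∇dφ` of a map `φ : (ℝᵐ, g) → (ℝⁿ, h)`. -/
def tension {m n : ℕ} (g : MetricField m) (h : MetricField n)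
    (φ : (Fin m → ℝ) → (Fin n → ℝ)) (x : Fin m → ℝ) : Fin n → ℝ :=
  ∑ i, ∑ j, (g x)⁻¹ i j • secondFundForm g h φ i j x

/-- The bitension field
`τ₂(φ) = Trace_g (∇^φ ∇^φ - ∇^φ_{∇^M}) τ(φ) - Trace_g R^N(dφ, τ(φ)) dφ`
of a map `φ : (ℝᵐ, g) → (ℝⁿ, h)`. -/
def bitension {m n : ℕ} (g : MetricField m) (h : MetricField n)
    (φ : (Fin m → ℝ) → (Fin n → ℝ)) (x : Fin m → ℝ) : Fin n → ℝ :=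
  (∑ i, ∑ j, (g x)⁻¹ i j •
    (covDeriv h φ i (covDeriv h φ j (tension g h φ)) x
      - ∑ k, christoffel g k i j x • covDeriv h φ k (tension g h φ) x))
  - ∑ i, ∑ j, (g x)⁻¹ i j •
      curvatureOp h (φ x) (dmap φ i x) (tension g h φ x) (dmap φ j x)

/-- The map `φ : (ℝᵐ, g) → (ℝⁿ, h)` is harmonic. -/
def IsHarmonicMap {m n : ℕ} (g : MetricField m) (h : MetricField n)
    (φ : (Fin m → ℝ) → (Fin n → ℝ)) : Prop :=
  ∀ x, tension g h φ x = 0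

/-- The map `φ : (ℝᵐ, g) → (ℝⁿ, h)` is biharmonic. -/
def IsBiharmonicMap {m n : ℕ} (g : MetricField m) (h : MetricField n)
    (φ : (Fin m → ℝ) → (Fin n → ℝ)) : Prop :=
  ∀ x, bitension g h φ x = 0

/-- The map `φ : (ℝᵐ, g) → (ℝⁿ, h)` is proper biharmonic: biharmonic and not harmonic. -/
def IsProperBiharmonicMap {m n : ℕ} (g : MetricField m) (h : MetricField n)
    (φ : (Fin m → ℝ) → (Fin n → ℝ)) : Prop :=
  IsBiharmonicMap g h φ ∧ ¬ IsHarmonicMap g h φ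

/-- The pullback `φ*h` of the metric `h`. -/
def pullback {m n : ℕ} (φ : (Fin m → ℝ) → (Fin n → ℝ)) (h : MetricField n) : MetricField m :=
  fun x => Matrix.of fun i j => metricInner h (φ x) (dmap φ i x) (dmap φ j x)

/-- The map `φ : (ℝᵐ, g) → (ℝⁿ, h)` between Riemannian manifolds is a conformal immersion with
conformal factor `μ > 0`, that is, a smooth immersion with `φ*h = μ² g`. -/
def IsConformalImmersion {m n : ℕ} (g : MetricField m) (h : MetricField n)
    (φ : (Fin m → ℝ) → (Fin n → ℝ)) (μ : (Fin m → ℝ) → ℝ) : Prop :=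
  IsRiemannianMetric g ∧ IsRiemannianMetric h ∧ ContDiff ℝ ∞ φ ∧
    (∀ x, Function.Injective (fderiv ℝ φ x)) ∧ (∀ x, 0 < μ x) ∧
    pullback φ h = rescale (fun x => μ x ^ 2) g

/-- The field `ξ` along `φ : ℝᵐ → (ℝⁿ, h)` is a smooth unit normal vector field. -/
def IsUnitNormal {m n : ℕ} (h : MetricField n) (φ : (Fin m → ℝ) → (Fin n → ℝ))
    (ξ : (Fin m → ℝ) → (Fin n → ℝ)) : Prop :=
  ContDiff ℝ ∞ ξ ∧ ∀ x, metricInner h (φ x) (ξ x) (ξ x) = 1 ∧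
    ∀ i, metricInner h (φ x) (ξ x) (dmap φ i x) = 0

/-- The mean curvature vector field `η = (1/m) Trace_g ∇dφ` of the isometric immersion
`φ : (ℝᵐ, g = φ*h) → (ℝⁿ, h)`. -/
def meanCurvatureVector {m n : ℕ} (h : MetricField n) (φ : (Fin m → ℝ) → (Fin n → ℝ))
    (x : Fin m → ℝ) : Fin n → ℝ :=
  (1 / (m : ℝ)) • tension (pullback φ h) h φ x

/-- The mean curvature `H = h(η, ξ)` with respect to the unit normal field `ξ`. -/
def meanCurvature {m n : ℕ} (h : MetricField n) (φ : (Fin m → ℝ) → (Fin n → ℝ))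
    (ξ : (Fin m → ℝ) → (Fin n → ℝ)) (x : Fin m → ℝ) : ℝ :=
  metricInner h (φ x) (meanCurvatureVector h φ x) (ξ x)

/-- The parametrized plane `(x, y) ↦ (x, y, a₁ x + a₂ y + a₃)`. -/
def planeMap (a₁ a₂ a₃ : ℝ) (p : Fin 2 → ℝ) : Fin 3 → ℝ :=
  ![p 0, p 1, a₁ * p 0 + a₂ * p 1 + a₃]

/-- The left-hand side of the second-order equation, at the point `q`, for a function `G` of the
coordinates `(x, y, z) = (q 0, q 1, q 2)`. -/
def planeOperator (a₁ a₂ : ℝ) (G : (Fin 3 → ℝ) → ℝ) (q : Fin 3 → ℝ) : ℝ :=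
  (1 + 2 * a₁ ^ 2 + a₂ ^ 2) / (1 + a₁ ^ 2 + a₂ ^ 2)
      * (G q * pd 0 (pd 0 G) q - 2 * pd 0 G q ^ 2)
    + (1 + a₁ ^ 2 + 2 * a₂ ^ 2) / (1 + a₁ ^ 2 + a₂ ^ 2)
      * (G q * pd 1 (pd 1 G) q - 2 * pd 1 G q ^ 2)
    + (2 + a₁ ^ 2 + a₂ ^ 2) / (1 + a₁ ^ 2 + a₂ ^ 2)
      * (G q * pd 2 (pd 2 G) q - 2 * pd 2 G q ^ 2)
    + 2 * a₁ * a₂ / (1 + a₁ ^ 2 + a₂ ^ 2)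
      * (G q * pd 1 (pd 0 G) q - 2 * pd 0 G q * pd 1 G q)
    - 2 * a₁ / (1 + a₁ ^ 2 + a₂ ^ 2)
      * (G q * pd 2 (pd 0 G) q - 2 * pd 0 G q * pd 2 G q)
    - 2 * a₂ / (1 + a₁ ^ 2 + a₂ ^ 2)
      * (G q * pd 2 (pd 1 G) q - 2 * pd 1 G q * pd 2 G q)

/-- The derivative `-a₁ G_x - a₂ G_y + G_z` of `G` in the direction `(-a₁, -a₂, 1)`. -/
def normalDeriv (a₁ a₂ : ℝ) (G : (Fin 3 → ℝ) → ℝ) (q : Fin 3 → ℝ) : ℝ :=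
  -a₁ * pd 0 G q - a₂ * pd 1 G q + pd 2 G q

end

end CoordGeom

/-! Everything is computed in the flat frame of the plane: the tangents T₁, T₂ (`planeTangent`) and
the normal ν (`planeNormal`). The target metric is G⁻² times the flat one, and the domain metric is
ρ times the constant matrix `planeGram` with ρ = (f G²)⁻¹. Write W = 1 + a₁² + a₂² and N for the
normal derivative of G. In dimension two a conformal factor does not affect the trace of the
Christoffel symbols, which is zero here (`trace_christoffel_rescale_planeGram`), so traces reduce to
constant-coefficient sums. The tension field is then G u ν with u = 2 f N / W. The factor G makes
the derivative of this field simple, because Gν/√W is a unit normal, parallel in the normal bundle,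
and the plane is umbilic (`covDeriv_smul_planeNormal`). Up to the factor ρ⁻¹, the bitension field
has normal part G Δu + u P / G, with P the `planeOperator` and Δ the Laplacian of `planeGram`, and
tangential part -2 N grad u (`bitension_planeMap`). Since N and u have the same zeros, the
tangential equation says that u² is constant. If the map is not harmonic, u is nowhere zero, hence
has zero derivatives, and the normal equation reduces to P = 0. Constancy of |u| = 2 f |N| / W is
the formula for f. Each step reverses. -/

namespace CoordGeom

noncomputable section

/-! ### Calculus of partial derivatives. -/

section

variable {n : ℕ}

theorem pd_add {f g : (Fin n → ℝ) → ℝ} {x : Fin n → ℝ} (i : Fin n) (hf : DifferentiableAt ℝ f x)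
    (hg : DifferentiableAt ℝ g x) : pd i (fun y => f y + g y) x = pd i f x + pd i g x := by
  simp only [pd]; rw [fderiv_fun_add hf hg]; rfl

theorem pd_mul {f g : (Fin n → ℝ) → ℝ} {x : Fin n → ℝ} (i : Fin n) (hf : DifferentiableAt ℝ f x)
    (hg : DifferentiableAt ℝ g x) :
    pd i (fun y => f y * g y) x = pd i f x * g x + f x * pd i g x := by
  simp only [pd]; rw [fderiv_fun_mul hf hg]; simp; ring

theorem pd_const_mul (i : Fin n) (c : ℝ) (f : (Fin n → ℝ) → ℝ) (x : Fin n → ℝ) :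
    pd i (fun y => c * f y) x = c * pd i f x := by
  simp only [pd]
  have := congrArg (fun L => L x) (fderiv_const_smul_field (𝕜 := ℝ) (f := f) c)
  have e : (fun y => c * f y) = c • f := by ext; simp
  rw [e, this]; simp

theorem pd_mul_const (i : Fin n) (c : ℝ) (f : (Fin n → ℝ) → ℝ) (x : Fin n → ℝ) :
    pd i (fun y => f y * c) x = pd i f x * c := by
  simp only [mul_comm _ c]; exact pd_const_mul i c f x

theorem pd_const (i : Fin n) (c : ℝ) (x : Fin n → ℝ) : pd i (fun _ => c) x = 0 := by
  simp [pd]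

theorem pd_inv {f : (Fin n → ℝ) → ℝ} {x : Fin n → ℝ} (i : Fin n) (hf : DifferentiableAt ℝ f x)
    (h0 : f x ≠ 0) : pd i (fun y => (f y)⁻¹) x = -pd i f x / f x ^ 2 := by
  have := ((hasDerivAt_inv h0).comp_hasFDerivAt x hf.hasFDerivAt).fderiv
  simp only [pd]
  change fderiv ℝ ((fun y => y⁻¹) ∘ f) x _ = _
  rw [this]; simp; ring

theorem pd_div {f g : (Fin n → ℝ) → ℝ} {x : Fin n → ℝ} (i : Fin n) (hf : DifferentiableAt ℝ f x)
    (hg : DifferentiableAt ℝ g x) (h0 : g x ≠ 0) :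
    pd i (fun y => f y / g y) x = (pd i f x * g x - f x * pd i g x) / g x ^ 2 := by
  simp only [div_eq_mul_inv (f _) (g _)]
  rw [pd_mul (g := fun y => (g y)⁻¹) i hf (hg.inv h0), pd_inv i hg h0]
  field_simp
  ring

theorem contDiff_pd {f : (Fin n → ℝ) → ℝ} (hf : ContDiff ℝ ∞ f) (i : Fin n) :
    ContDiff ℝ ∞ (pd i f) := by
  have : ContDiff ℝ ∞ (fderiv ℝ f) := hf.fderiv_right (by simp)
  exact this.clm_apply contDiff_const

theorem pd_comm {f : (Fin n → ℝ) → ℝ} (hf : ContDiff ℝ ∞ f) (i j : Fin n) (x : Fin n → ℝ) :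
    pd i (pd j f) x = pd j (pd i f) x := by
  have hs : IsSymmSndFDerivAt ℝ f x :=
    hf.contDiffAt.isSymmSndFDerivAt (by
      rw [minSmoothness_of_isRCLikeNormedField]
      exact WithTop.coe_le_coe.2 (le_top : (2 : ℕ∞) ≤ ⊤))
  have hd : DifferentiableAt ℝ (fderiv ℝ f) x :=
    (hf.fderiv_right (m := ∞) (by simp)).differentiable (by simp) x
  have key (k l : Fin n) : pd k (pd l f) x
      = fderiv ℝ (fderiv ℝ f) x (Pi.single k 1) (Pi.single l 1) := by
    change fderiv ℝ (fun y => fderiv ℝ f y (Pi.single l 1)) x _ = _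
    rw [fderiv_clm_apply hd (differentiableAt_const _)]
    simp
  rw [key, key, hs]

/-! ### Connection and curvature of a conformally flat metric. -/

/-- The conformally flat metric `G⁻² (dx₁² + ⋯ + dxₙ²)`. -/
def conformalMetric (G : (Fin n → ℝ) → ℝ) : MetricField n :=
  rescale (fun q => (G q ^ 2)⁻¹) (euclideanMetric n)

theorem conformalMetric_apply (G : (Fin n → ℝ) → ℝ) (q : Fin n → ℝ) (i j : Fin n) :
    conformalMetric G q i j = (G q ^ 2)⁻¹ * if i = j then 1 else 0 := by
  simp [conformalMetric, rescale, euclideanMetric, Matrix.one_apply]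

theorem inv_conformalMetric {G : (Fin n → ℝ) → ℝ} {q : Fin n → ℝ} (h0 : G q ≠ 0) :
    (conformalMetric G q)⁻¹ = G q ^ 2 • (1 : Matrix (Fin n) (Fin n) ℝ) := by
  apply Matrix.inv_eq_left_inv
  simp [conformalMetric, rescale, euclideanMetric, smul_smul, h0]

variable {G : (Fin n → ℝ) → ℝ} (hG : ContDiff ℝ ∞ G) (h0 : ∀ q, 0 < G q)

include hG h0 in
theorem pd_conformalMetric (i j k : Fin n) (q : Fin n → ℝ) :
    pd i (fun y => conformalMetric G y j k) q
      = -2 * pd i G q / G q ^ 3 * if j = k then 1 else 0 := by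
  have hd : DifferentiableAt ℝ G q := hG.differentiable (by simp) q
  simp only [conformalMetric_apply, pd_mul_const]
  rw [pd_inv (f := fun y => G y ^ 2) i (hd.pow 2) (pow_ne_zero _ (h0 q).ne')]
  simp only [pow_two, pd_mul i hd hd]
  have := (h0 q).ne'
  field_simp
  ring

include hG h0 in
theorem christoffel_conformalMetric (k i j : Fin n) (q : Fin n → ℝ) :
    christoffel (conformalMetric G) k i j q = (if k = i then 1 else 0) * (-pd j G q / G q)
      + (if k = j then 1 else 0) * (-pd i G q / G q)
      - (if i = j then 1 else 0) * (-pd k G q / G q) := by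
  have := (h0 q).ne'
  simp only [christoffel, pd_conformalMetric hG h0, inv_conformalMetric this, Matrix.smul_apply,
    Matrix.one_apply, smul_eq_mul, mul_ite, ite_mul, mul_one, mul_zero, zero_mul,
    Finset.sum_ite_eq, Finset.mem_univ, if_true]
  simp only [eq_comm (a := j) (b := k), eq_comm (a := i) (b := k)]
  split_ifs <;> field_simp <;> ring

include hG h0 in
theorem sum_christoffel_conformalMetric (k : Fin n) (q X Y : Fin n → ℝ) :
    ∑ b, ∑ c, christoffel (conformalMetric G) k b c q * X b * Y c
      = -(X k * ∑ b, pd b G q * Y b + Y k * ∑ b, pd b G q * X b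
        - (∑ b, X b * Y b) * pd k G q) / G q := by
  simp only [christoffel_conformalMetric hG h0, add_mul, sub_mul, ite_mul, one_mul, zero_mul,
    Finset.sum_add_distrib, Finset.sum_sub_distrib, Finset.sum_ite_eq, Finset.mem_univ, if_true,
    Finset.sum_ite_irrel, Finset.sum_const_zero]
  simp only [neg_div, sub_div, add_div, Finset.mul_sum, Finset.sum_mul, Finset.sum_div]
  simp only [← Finset.sum_add_distrib, ← Finset.sum_sub_distrib, ← Finset.sum_neg_distrib]
  exact Finset.sum_congr rfl fun _ _ => by ring

include hG h0 in
theorem pd_christoffel_conformalMetric (l k i j : Fin n) (q : Fin n → ℝ) :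
    pd l (christoffel (conformalMetric G) k i j) q =
      (if k = i then 1 else 0) * (pd l G q * pd j G q / G q ^ 2 - pd l (pd j G) q / G q)
      + (if k = j then 1 else 0) * (pd l G q * pd i G q / G q ^ 2 - pd l (pd i G) q / G q)
      - (if i = j then 1 else 0) * (pd l G q * pd k G q / G q ^ 2 - pd l (pd k G) q / G q) := by
  have h := (h0 q).ne'
  have hd : DifferentiableAt ℝ G q := hG.differentiable (by simp) q
  have hd' (i : Fin n) : DifferentiableAt ℝ (pd i G) q :=
    (contDiff_pd hG i).differentiable (by simp) q
  -- With G as a single common denominator, one use of the quotient rule suffices.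
  have e : christoffel (conformalMetric G) k i j = fun y =>
      ((if k = i then -1 else 0) * pd j G y + (if k = j then -1 else 0) * pd i G y
        + (if i = j then 1 else 0) * pd k G y) / G y := by
    ext y
    rw [christoffel_conformalMetric hG h0]
    split_ifs <;> ring
  rw [e, pd_div l (by fun_prop) hd h, pd_add l (by fun_prop) (by fun_prop),
    pd_add l (by fun_prop) (by fun_prop)]
  simp only [pd_const_mul]
  split_ifs <;> field_simp <;> ring

-- With the conformal factor written as G⁻², the products ∂ᵢG ∂ⱼG cancel between the derivative and
-- the quadratic terms. Only the Hessian of G and |∇G|² survive.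
include hG h0 in
theorem curvature_conformalMetric (i j k l : Fin n) (q : Fin n → ℝ) :
    curvature (conformalMetric G) i j k l q =
      (if i = l then 1 else 0) * (pd j (pd k G) q / G q)
      - (if j = l then 1 else 0) * (pd i (pd k G) q / G q)
      + (if j = k then 1 else 0) * (pd i (pd l G) q / G q)
      - (if i = k then 1 else 0) * (pd j (pd l G) q / G q)
      - ((if j = k then 1 else 0) * (if i = l then 1 else 0)
        - (if i = k then 1 else 0) * (if j = l then 1 else 0))
        * ((∑ s, pd s G q ^ 2) / G q ^ 2) := by
  have h := (h0 q).ne'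
  have key (i j : Fin n) : ∑ s, christoffel (conformalMetric G) s j k q
      * christoffel (conformalMetric G) l i s q =
      (pd k G q / G q) * ((if l = i then 1 else 0) * (pd j G q / G q)
        + (if l = j then 1 else 0) * (pd i G q / G q) - (if i = j then 1 else 0) * (pd l G q / G q))
      + (pd j G q / G q) * ((if l = i then 1 else 0) * (pd k G q / G q)
        + (if l = k then 1 else 0) * (pd i G q / G q) - (if i = k then 1 else 0) * (pd l G q / G q))
      - (if j = k then 1 else 0) * (if l = i then 1 else 0) * ((∑ s, pd s G q ^ 2) / G q ^ 2) := by
    have e : (∑ s, pd s G q ^ 2) / G q ^ 2 = ∑ s, (pd s G q / G q) * (pd s G q / G q) := by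
      rw [Finset.sum_div]; congr 1; ext s; ring
    -- γ is the gradient of log G; the Christoffel symbols are linear in it.
    obtain ⟨γ, hγ⟩ : ∃ γ : Fin n → ℝ, ∀ s, pd s G q / G q = γ s := ⟨_, fun _ => rfl⟩
    simp only [christoffel_conformalMetric hG h0, e, neg_div, hγ]
    have hT (T : Fin n → ℝ) (a b c : ℝ) : ∑ s, ((if s = j then 1 else 0) * a
        + (if s = k then 1 else 0) * b - c * -γ s) * T s
        = a * T j + b * T k + c * ∑ s, γ s * T s := by
      simp [add_mul, Finset.sum_add_distrib, Finset.mul_sum, mul_assoc]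
    -- The last two terms of the symbol contribute γₗγᵢ with opposite signs, which leaves |γ|².
    have hγγ : ∑ s, γ s * ((if l = i then 1 else 0) * -γ s + (if l = s then 1 else 0) * -γ i
        - (if i = s then 1 else 0) * -γ l) = -((if l = i then 1 else 0) * ∑ s, γ s * γ s) := by
      simp only [ite_mul, one_mul, zero_mul, mul_add, mul_sub, mul_ite, mul_zero, Finset.sum_ite_eq,
        Finset.sum_add_distrib, Finset.sum_sub_distrib, Finset.mem_univ, if_true]
      split_ifs <;> simp [mul_comm]
    rw [hT, hγγ]
    ring
  simp only [curvature, Finset.sum_sub_distrib, key, pd_christoffel_conformalMetric hG h0]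
  rw [pd_comm hG j i, pd_comm hG j k, pd_comm hG i k]
  simp only [eq_comm (a := j) (b := l), eq_comm (a := i) (b := l), eq_comm (a := j) (b := i)]
  ring

end

/-! ### The plane, its frame and its tension field. -/

section

theorem pd_comp {m n : ℕ} {K : (Fin n → ℝ) → ℝ} {φ : (Fin m → ℝ) → (Fin n → ℝ)} {p : Fin m → ℝ}
    (i : Fin m) (hK : DifferentiableAt ℝ K (φ p)) (hφ : DifferentiableAt ℝ φ p) :
    pd i (fun y => K (φ y)) p = ∑ b, pd b K (φ p) * dmap φ i p b := by
  have e (b : Fin n) : dmap φ i p b = fderiv ℝ φ p (Pi.single i 1) b := by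
    simp only [dmap, pd]
    rw [fderiv_pi (fun b => differentiableAt_pi.1 hφ b)]
    rfl
  simp only [e]
  simp only [pd]
  change fderiv ℝ (K ∘ φ) p _ = _
  rw [fderiv_comp p hK hφ]
  conv_lhs => rw [ContinuousLinearMap.comp_apply, pi_eq_sum_univ' (fderiv ℝ φ p (Pi.single i 1)),
    map_sum]
  refine Finset.sum_congr rfl fun b _ => ?_
  rw [map_smul, smul_eq_mul, mul_comm]

variable (a₁ a₂ a₃ : ℝ)

/-- The coordinate vector fields of the parametrized plane. -/
def planeTangent (i : Fin 2) : Fin 3 → ℝ := ![![1, 0, a₁], ![0, 1, a₂]] i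

/-- The normal vector `(-a₁, -a₂, 1)` of the plane. -/
def planeNormal : Fin 3 → ℝ := ![-a₁, -a₂, 1]

/-- The Gram matrix of the coordinate vector fields of the plane, for the flat metric. -/
def planeGram : Matrix (Fin 2) (Fin 2) ℝ := !![1 + a₁ ^ 2, a₁ * a₂; a₁ * a₂, 1 + a₂ ^ 2]

theorem contDiff_planeMap : ContDiff ℝ ∞ (planeMap a₁ a₂ a₃) := by
  rw [contDiff_pi]
  intro b
  fin_cases b <;> simp [planeMap] <;> fun_prop

theorem pd_coord {n : ℕ} (i j : Fin n) (x : Fin n → ℝ) :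
    pd i (fun y => y j) x = if i = j then 1 else 0 := by
  simp only [pd]
  rw [(hasFDerivAt_apply j x).fderiv]
  simp [Pi.single_apply, eq_comm]

theorem dmap_planeMap (i : Fin 2) (p : Fin 2 → ℝ) :
    dmap (planeMap a₁ a₂ a₃) i p = planeTangent a₁ a₂ i := by
  have hz : pd i (fun y : Fin 2 → ℝ => a₁ * y 0 + a₂ * y 1 + a₃) p
      = a₁ * pd i (fun y => y 0) p + a₂ * pd i (fun y => y 1) p := by
    rw [pd_add i (by fun_prop) (by fun_prop), pd_add i (by fun_prop) (by fun_prop), pd_const_mul,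
      pd_const_mul, pd_const, add_zero]
  ext b
  fin_cases i <;> fin_cases b <;> simp [dmap, planeMap, planeTangent, pd_coord] at hz ⊢ <;>
    exact hz

theorem planeNorm_pos : 0 < 1 + a₁ ^ 2 + a₂ ^ 2 := by positivity

theorem inv_planeGram : (planeGram a₁ a₂)⁻¹ = (1 + a₁ ^ 2 + a₂ ^ 2)⁻¹ •
    !![1 + a₂ ^ 2, -(a₁ * a₂); -(a₁ * a₂), 1 + a₁ ^ 2] := by
  have := (planeNorm_pos a₁ a₂).ne'
  rw [Matrix.inv_def]
  simp only [planeGram, Matrix.det_fin_two_of, Matrix.adjugate_fin_two_of, Ring.inverse_eq_inv']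
  congr 2
  ring

theorem pullback_conformalMetric (G : (Fin 3 → ℝ) → ℝ) :
    pullback (planeMap a₁ a₂ a₃) (conformalMetric G)
      = rescale (fun p => (G (planeMap a₁ a₂ a₃ p) ^ 2)⁻¹) fun _ => planeGram a₁ a₂ := by
  ext p i j
  simp only [pullback, metricInner, dmap_planeMap, conformalMetric_apply, rescale]
  fin_cases i <;> fin_cases j <;>
    simp [Fin.sum_univ_three, planeTangent, planeGram] <;> ring

theorem inv_rescale_planeGram {ρ : (Fin 2 → ℝ) → ℝ} {p : Fin 2 → ℝ} (h0 : ρ p ≠ 0) :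
    (rescale ρ (fun _ => planeGram a₁ a₂) p)⁻¹ = (ρ p)⁻¹ • (planeGram a₁ a₂)⁻¹ := by
  apply Matrix.inv_eq_left_inv
  have hd : IsUnit (planeGram a₁ a₂).det := by
    rw [isUnit_iff_ne_zero, planeGram, Matrix.det_fin_two_of]
    nlinarith [planeNorm_pos a₁ a₂]
  simp [rescale, smul_smul, h0, Matrix.nonsing_inv_mul _ hd]

/-- This is conformal invariance in dimension two: in dimension m the trace is proportional to (2 -
m) dρ. It makes the Cartesian parameters harmonic coordinates for every ρ. -/
theorem trace_christoffel_rescale_planeGram {ρ : (Fin 2 → ℝ) → ℝ} {p : Fin 2 → ℝ} (h0 : ρ p ≠ 0)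
    (k : Fin 2) : ∑ i, ∑ j, (planeGram a₁ a₂)⁻¹ i j
      * christoffel (rescale ρ fun _ => planeGram a₁ a₂) k i j p = 0 := by
  have := (planeNorm_pos a₁ a₂).ne'
  have e (i j k : Fin 2) : pd i (fun y => rescale ρ (fun _ => planeGram a₁ a₂) y j k) p
      = pd i ρ p * planeGram a₁ a₂ j k := by
    simp [rescale, pd_mul_const]
  simp only [christoffel, e, inv_rescale_planeGram a₁ a₂ h0, inv_planeGram]
  fin_cases k <;> simp [Fin.sum_univ_two, planeGram] <;> field_simp <;> ring

variable {a₁ a₂ a₃} {G : (Fin 3 → ℝ) → ℝ} (hG : ContDiff ℝ ∞ G) (h0 : ∀ q, 0 < G q)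

/-- Serves both the tension and the bitension: the connection of the domain drops out of each trace.
-/
theorem sum_smul_sub_christoffel {ρ : (Fin 2 → ℝ) → ℝ} {p : Fin 2 → ℝ} (hρ : ρ p ≠ 0)
    (A : Fin 2 → Fin 2 → Fin 3 → ℝ) (B : Fin 2 → Fin 3 → ℝ) :
    ∑ i, ∑ j, (rescale ρ (fun _ => planeGram a₁ a₂) p)⁻¹ i j
      • (A i j - ∑ k, christoffel (rescale ρ fun _ => planeGram a₁ a₂) k i j p • B k)
      = (ρ p)⁻¹ • ∑ i, ∑ j, (planeGram a₁ a₂)⁻¹ i j • A i j := by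
  have h (k) := trace_christoffel_rescale_planeGram a₁ a₂ hρ k
  simp only [Fin.sum_univ_two] at h
  rw [inv_rescale_planeGram a₁ a₂ hρ]
  ext α
  simp only [Fin.sum_univ_two, Matrix.smul_apply, smul_eq_mul, Pi.smul_apply, Pi.add_apply,
    Pi.sub_apply]
  linear_combination -(ρ p)⁻¹ * B 0 α * h 0 - (ρ p)⁻¹ * B 1 α * h 1

include hG h0 in
theorem covDeriv_planeMap (i : Fin 2) {V : (Fin 2 → ℝ) → Fin 3 → ℝ} (p : Fin 2 → ℝ) :
    covDeriv (conformalMetric G) (planeMap a₁ a₂ a₃) i V p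
      = fun α => pd i (fun y => V y α) p
        - (planeTangent a₁ a₂ i α * ∑ b, pd b G (planeMap a₁ a₂ a₃ p) * V p b
          + V p α * ∑ b, pd b G (planeMap a₁ a₂ a₃ p) * planeTangent a₁ a₂ i b
          - (∑ b, planeTangent a₁ a₂ i b * V p b) * pd α G (planeMap a₁ a₂ a₃ p))
          / G (planeMap a₁ a₂ a₃ p) := by
  ext α
  simp only [covDeriv, sum_christoffel_conformalMetric hG h0, dmap_planeMap]
  ring

include hG h0 in
theorem tension_planeMap {ρ : (Fin 2 → ℝ) → ℝ} {p : Fin 2 → ℝ} (hρ : ρ p ≠ 0) :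
    tension (rescale ρ fun _ => planeGram a₁ a₂) (conformalMetric G) (planeMap a₁ a₂ a₃) p
      = (2 * normalDeriv a₁ a₂ G (planeMap a₁ a₂ a₃ p)
        / (ρ p * G (planeMap a₁ a₂ a₃ p) * (1 + a₁ ^ 2 + a₂ ^ 2))) • planeNormal a₁ a₂ := by
  have := (planeNorm_pos a₁ a₂).ne'
  have := (h0 (planeMap a₁ a₂ a₃ p)).ne'
  simp only [tension, secondFundForm]
  rw [sum_smul_sub_christoffel hρ]
  simp only [covDeriv_planeMap hG h0, dmap_planeMap, pd_const, inv_planeGram]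
  ext α
  fin_cases α <;>
    simp [Fin.sum_univ_two, Fin.sum_univ_three, planeTangent, planeNormal, normalDeriv] <;>
    field_simp <;> ring

include hG in
theorem pd_comp_planeMap (i : Fin 2) (p : Fin 2 → ℝ) :
    pd i (fun y => G (planeMap a₁ a₂ a₃ y)) p
      = ∑ b, pd b G (planeMap a₁ a₂ a₃ p) * planeTangent a₁ a₂ i b := by
  rw [pd_comp i (hG.differentiable (by simp) _)
    ((contDiff_planeMap a₁ a₂ a₃).differentiable (by simp) _)]
  simp only [dmap_planeMap]

-- The derivative of G along the plane cancels the normal part of the Christoffel correction. What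
-- remains is the Weingarten formula of an umbilic surface: no Tⱼ with j ≠ i occurs.
include hG h0 in
theorem covDeriv_smul_planeNormal {u : (Fin 2 → ℝ) → ℝ} (hu : ContDiff ℝ ∞ u) (i : Fin 2)
    (p : Fin 2 → ℝ) :
    covDeriv (conformalMetric G) (planeMap a₁ a₂ a₃) i
        (fun y => (G (planeMap a₁ a₂ a₃ y) * u y) • planeNormal a₁ a₂) p
      = (G (planeMap a₁ a₂ a₃ p) * pd i u p) • planeNormal a₁ a₂
        - (u p * normalDeriv a₁ a₂ G (planeMap a₁ a₂ a₃ p)) • planeTangent a₁ a₂ i := by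
  have := (h0 (planeMap a₁ a₂ a₃ p)).ne'
  have hd : DifferentiableAt ℝ (fun y => G (planeMap a₁ a₂ a₃ y)) p :=
    (hG.comp (contDiff_planeMap a₁ a₂ a₃)).differentiable (by simp) p
  have hu' := hu.differentiable (by simp) p
  rw [covDeriv_planeMap hG h0]
  simp only [Pi.smul_apply, smul_eq_mul, pd_mul_const, pd_mul i hd hu', pd_comp_planeMap hG]
  ext α
  fin_cases i <;> fin_cases α <;>
    simp [Fin.sum_univ_three, planeTangent, planeNormal, normalDeriv] <;>
    field_simp <;> ring

end

/-! ### The bitension field of the plane. -/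

section

variable {a₁ a₂ a₃ : ℝ} {G : (Fin 3 → ℝ) → ℝ} (hG : ContDiff ℝ ∞ G) (h0 : ∀ q, 0 < G q)

include hG in
theorem contDiff_normalDeriv : ContDiff ℝ ∞ (normalDeriv a₁ a₂ G) := by
  unfold normalDeriv
  exact ((contDiff_const.mul (contDiff_pd hG 0)).sub (contDiff_const.mul (contDiff_pd hG 1))).add
    (contDiff_pd hG 2)

include hG in
theorem pd_normalDeriv (i : Fin 3) (q : Fin 3 → ℝ) : pd i (normalDeriv a₁ a₂ G) q
    = -a₁ * pd i (pd 0 G) q - a₂ * pd i (pd 1 G) q + pd i (pd 2 G) q := by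
  have hd (j) : DifferentiableAt ℝ (pd j G) q := (contDiff_pd hG j).differentiable (by simp) q
  have e : normalDeriv a₁ a₂ G = fun q => -a₁ * pd 0 G q + -a₂ * pd 1 G q + pd 2 G q := by
    ext; simp only [normalDeriv]; ring
  have h (j) (c : ℝ) : DifferentiableAt ℝ (fun q => c * pd j G q) q := (hd j).const_mul c
  rw [e, pd_add i ((h 0 _).fun_add (h 1 _)) (hd 2), pd_add i (h 0 _) (h 1 _)]
  simp only [pd_const_mul]
  ring

include hG h0 in
theorem covDeriv_covDeriv_smul_planeNormal {u : (Fin 2 → ℝ) → ℝ} (hu : ContDiff ℝ ∞ u)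
    (i j : Fin 2) (p : Fin 2 → ℝ) :
    covDeriv (conformalMetric G) (planeMap a₁ a₂ a₃) i
        (covDeriv (conformalMetric G) (planeMap a₁ a₂ a₃) j
          fun y => (G (planeMap a₁ a₂ a₃ y) * u y) • planeNormal a₁ a₂) p
      = fun α => G (planeMap a₁ a₂ a₃ p) * pd i (pd j u) p * planeNormal a₁ a₂ α
        - normalDeriv a₁ a₂ G (planeMap a₁ a₂ a₃ p)
          * (pd j u p * planeTangent a₁ a₂ i α + pd i u p * planeTangent a₁ a₂ j α)
        - u p * (∑ b, planeTangent a₁ a₂ i b * pd b (normalDeriv a₁ a₂ G) (planeMap a₁ a₂ a₃ p))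
          * planeTangent a₁ a₂ j α
        + u p * normalDeriv a₁ a₂ G (planeMap a₁ a₂ a₃ p) / G (planeMap a₁ a₂ a₃ p)
          * (planeTangent a₁ a₂ i α
              * ∑ b, pd b G (planeMap a₁ a₂ a₃ p) * planeTangent a₁ a₂ j b
            + planeTangent a₁ a₂ j α
              * ∑ b, pd b G (planeMap a₁ a₂ a₃ p) * planeTangent a₁ a₂ i b
            - planeGram a₁ a₂ i j * pd α G (planeMap a₁ a₂ a₃ p)) := by
  have := (h0 (planeMap a₁ a₂ a₃ p)).ne'
  have hN : ContDiff ℝ ∞ (normalDeriv a₁ a₂ G) := contDiff_normalDeriv hG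
  have hd : DifferentiableAt ℝ (fun y => G (planeMap a₁ a₂ a₃ y)) p :=
    (hG.comp (contDiff_planeMap a₁ a₂ a₃)).differentiable (by simp) p
  have hd' : DifferentiableAt ℝ (fun y => normalDeriv a₁ a₂ G (planeMap a₁ a₂ a₃ y)) p :=
    (hN.comp (contDiff_planeMap a₁ a₂ a₃)).differentiable (by simp) p
  have hu' := hu.differentiable (by simp) p
  have hu'' (j) := (contDiff_pd hu j).differentiable (by simp) p
  have hm := hd.fun_mul (hu'' j)
  have hm' := hu'.fun_mul hd'
  have e (α : Fin 3) : pd i (fun y =>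
        ((G (planeMap a₁ a₂ a₃ y) * pd j u y) • planeNormal a₁ a₂
        - (u y * normalDeriv a₁ a₂ G (planeMap a₁ a₂ a₃ y)) • planeTangent a₁ a₂ j) α) p
      = pd i (fun y => (G (planeMap a₁ a₂ a₃ y) * pd j u y)) p * planeNormal a₁ a₂ α
        - pd i (fun y => u y * normalDeriv a₁ a₂ G (planeMap a₁ a₂ a₃ y)) p
          * planeTangent a₁ a₂ j α := by
    simp only [Pi.sub_apply, Pi.smul_apply, smul_eq_mul, sub_eq_add_neg, ← mul_neg]
    rw [pd_add i (hm.mul_const _) (hm'.mul_const _), pd_mul_const, pd_mul_const]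
  have hc := funext (covDeriv_smul_planeNormal (a₁ := a₁) (a₂ := a₂) (a₃ := a₃) hG h0 hu j)
  rw [hc, covDeriv_planeMap hG h0]
  simp only [e, pd_mul i hd (hu'' j), pd_mul i hu' hd', pd_comp_planeMap hG, pd_comp_planeMap hN]
  generalize pd i (pd j u) p = uij
  have hNN : normalDeriv a₁ a₂ G (planeMap a₁ a₂ a₃ p) = -a₁ * pd 0 G (planeMap a₁ a₂ a₃ p)
    - a₂ * pd 1 G (planeMap a₁ a₂ a₃ p) + pd 2 G (planeMap a₁ a₂ a₃ p) := rfl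
  ext α
  fin_cases i <;> fin_cases j <;> fin_cases α <;>
    simp [Fin.sum_univ_three, planeTangent, planeNormal, planeGram] <;>
    field_simp <;> rw [hNN] <;> ring

include hG h0 in
theorem curvatureOp_conformalMetric (q X Y Z : Fin 3 → ℝ) :
    curvatureOp (conformalMetric G) q X Y Z = fun l =>
      ((∑ j, ∑ k, Y j * Z k * pd j (pd k G) q) * X l - (∑ i, ∑ k, X i * Z k * pd i (pd k G) q) * Y l
        + (∑ j, Y j * Z j) * ∑ i, X i * pd i (pd l G) q
        - (∑ j, X j * Z j) * ∑ i, Y i * pd i (pd l G) q) / G q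
      - ((∑ j, Y j * Z j) * X l - (∑ j, X j * Z j) * Y l) * ((∑ s, pd s G q ^ 2) / G q ^ 2) := by
  ext l
  simp only [curvatureOp, curvature_conformalMetric hG h0]
  -- Kept as an atom so that expanding the index sums leaves |∇G|² alone.
  generalize (∑ s, pd s G q ^ 2) / G q ^ 2 = S
  fin_cases l <;> simp [Fin.sum_univ_three] <;> ring

-- In the traced second derivative, the terms with tangential derivatives of N cancel against the
-- tangential part of the curvature, as in the Codazzi equation. The tangential part of ∇G cancels
-- as well, and its normal part, together with the curvature, builds `planeOperator`.
include hG h0 in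
theorem bitension_planeMap {ρ u : (Fin 2 → ℝ) → ℝ} (hρ : ∀ p, ρ p ≠ 0) (hu : ContDiff ℝ ∞ u)
    (ht : tension (rescale ρ fun _ => planeGram a₁ a₂) (conformalMetric G) (planeMap a₁ a₂ a₃)
      = fun p => (G (planeMap a₁ a₂ a₃ p) * u p) • planeNormal a₁ a₂) (p : Fin 2 → ℝ) :
    bitension (rescale ρ fun _ => planeGram a₁ a₂) (conformalMetric G) (planeMap a₁ a₂ a₃) p
      = (ρ p)⁻¹ • ((G (planeMap a₁ a₂ a₃ p)
            * ∑ i, ∑ j, (planeGram a₁ a₂)⁻¹ i j * pd i (pd j u) p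
          + u p * planeOperator a₁ a₂ G (planeMap a₁ a₂ a₃ p) / G (planeMap a₁ a₂ a₃ p))
            • planeNormal a₁ a₂
        - (2 * normalDeriv a₁ a₂ G (planeMap a₁ a₂ a₃ p)) • ∑ i, ∑ j,
          ((planeGram a₁ a₂)⁻¹ i j * pd i u p) • planeTangent a₁ a₂ j) := by
  have := (planeNorm_pos a₁ a₂).ne'
  have := (h0 (planeMap a₁ a₂ a₃ p)).ne'
  simp only [bitension]
  rw [sum_smul_sub_christoffel (hρ p), inv_rescale_planeGram a₁ a₂ (hρ p)]
  simp only [Matrix.smul_apply, smul_assoc, ← Finset.smul_sum, ← smul_sub]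
  congr 1
  simp only [ht, covDeriv_covDeriv_smul_planeNormal hG h0 hu, dmap_planeMap,
    curvatureOp_conformalMetric hG h0, pd_normalDeriv hG, inv_planeGram]
  generalize planeMap a₁ a₂ a₃ p = q at *
  have hNN : normalDeriv a₁ a₂ G q = -a₁ * pd 0 G q - a₂ * pd 1 G q + pd 2 G q := rfl
  have h10 := pd_comm hG 1 0 q
  have h20 := pd_comm hG 2 0 q
  have h21 := pd_comm hG 2 1 q
  have hu10 := pd_comm hu 1 0 p
  ext α
  fin_cases α <;>
    simp [Fin.sum_univ_two, Fin.sum_univ_three, planeTangent, planeNormal, planeGram,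
      planeOperator, hNN, h10, h20, h21, hu10] <;>
    field_simp <;> ring

end

/-! ### Solving the biharmonic equation. -/

section

theorem eq_of_pd_eq_zero {n : ℕ} {f : (Fin n → ℝ) → ℝ} (hf : ContDiff ℝ ∞ f)
    (h : ∀ i x, pd i f x = 0) (x y : Fin n → ℝ) : f x = f y := by
  refine is_const_of_fderiv_eq_zero (𝕜 := ℝ) (hf.differentiable (by simp)) (fun z => ?_) x y
  ext v
  rw [pi_eq_sum_univ' v, map_sum]
  simp only [map_smul]
  refine Finset.sum_eq_zero fun i _ => ?_
  have := h i z
  simp only [pd] at this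
  convert smul_zero (v i)

/-- Passing to u² gives constancy without first excluding zeros of u. -/
theorem eq_of_mul_pd_eq_zero {n : ℕ} {u : (Fin n → ℝ) → ℝ} (hu : ContDiff ℝ ∞ u)
    (h : ∀ i x, u x * pd i u x = 0) (x y : Fin n → ℝ) : u x * u x = u y * u y := by
  refine eq_of_pd_eq_zero (hu.mul hu) (fun i z => ?_) x y
  have hd : DifferentiableAt ℝ u z := hu.differentiable (by simp) z
  rw [pd_mul i hd hd]
  linarith [h i z]

variable {a₁ a₂ a₃ : ℝ} {G : (Fin 3 → ℝ) → ℝ} (hG : ContDiff ℝ ∞ G) (h0 : ∀ q, 0 < G q)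

theorem posDef_planeGram : (planeGram a₁ a₂).PosDef := by
  refine Matrix.PosDef.of_dotProduct_mulVec_pos ?_ fun v hv => ?_
  · ext i j
    fin_cases i <;> fin_cases j <;> simp [planeGram]
  · have e : star v ⬝ᵥ Matrix.mulVec (planeGram a₁ a₂) v
        = v 0 ^ 2 + v 1 ^ 2 + (a₁ * v 0 + a₂ * v 1) ^ 2 := by
      simp [planeGram, dotProduct, Matrix.mulVec, Fin.sum_univ_two]
      ring
    rw [e]
    rcases eq_or_ne (v 0) 0 with h | h
    · have : v 1 ≠ 0 := fun h' => hv (by ext i; fin_cases i <;> simp [h, h'])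
      positivity
    · positivity

theorem isRiemannianMetric_rescale_planeGram {ρ : (Fin 2 → ℝ) → ℝ} (hρ : ContDiff ℝ ∞ ρ)
    (hρ0 : ∀ p, 0 < ρ p) : IsRiemannianMetric (rescale ρ fun _ => planeGram a₁ a₂) := by
  refine ⟨fun i j => ?_, fun p => ?_⟩
  · simp only [rescale, Matrix.smul_apply, smul_eq_mul]
    fun_prop
  · exact posDef_planeGram.smul (hρ0 p)

include hG h0 in
theorem isRiemannianMetric_conformalMetric : IsRiemannianMetric (conformalMetric G) := by
  refine ⟨fun i j => ?_, fun q => ?_⟩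
  · simp only [conformalMetric_apply]
    exact ((hG.pow 2).inv fun q => pow_ne_zero _ (h0 q).ne').mul contDiff_const
  · exact Matrix.PosDef.one.smul (inv_pos.2 (pow_pos (h0 q) 2))

theorem injective_fderiv_planeMap (p : Fin 2 → ℝ) :
    Function.Injective (fderiv ℝ (planeMap a₁ a₂ a₃) p) := by
  have hd := (contDiff_planeMap a₁ a₂ a₃).differentiable (by simp) p
  have e (v : Fin 2 → ℝ) (b : Fin 3) : fderiv ℝ (planeMap a₁ a₂ a₃) p v b
      = fderiv ℝ (fun y => planeMap a₁ a₂ a₃ y b) p v := by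
    rw [fderiv_pi (fun b => differentiableAt_pi.1 hd b)]
    rfl
  have ez (v : Fin 2 → ℝ) (i : Fin 2) : fderiv ℝ (fun y : Fin 2 → ℝ => y i) p v = v i := by
    rw [(hasFDerivAt_apply i p).fderiv]; rfl
  intro v w h
  have h1 := congrFun h 0
  have h2 := congrFun h 1
  rw [e, e] at h1 h2
  ext i
  fin_cases i
  · simpa [planeMap, ez] using h1
  · simpa [planeMap, ez] using h2

/-- Separates the normal and tangential equations, since ν, T₁, T₂ are linearly independent and
`planeGram` is invertible. -/
theorem smul_planeNormal_sub_eq_zero {c d₀ : ℝ} (u : Fin 2 → ℝ)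
    (h : c • planeNormal a₁ a₂ - d₀ • ∑ i, ∑ j,
      ((planeGram a₁ a₂)⁻¹ i j * u i) • planeTangent a₁ a₂ j = 0) :
    c = 0 ∧ ∀ i, d₀ * u i = 0 := by
  have hW := (planeNorm_pos a₁ a₂).ne'
  have e0 := congrFun h 0
  have e1 := congrFun h 1
  have e2 := congrFun h 2
  simp only [inv_planeGram, planeNormal, planeTangent, Fin.sum_univ_two, Pi.sub_apply,
    Pi.smul_apply, Pi.add_apply, Matrix.smul_apply, smul_eq_mul, Pi.zero_apply, Matrix.of_apply,
    Matrix.cons_val', Matrix.cons_val_zero, Matrix.cons_val_one, Matrix.cons_val_fin_one,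
    Matrix.cons_val, mul_zero, mul_one, add_zero, zero_add] at e0 e1 e2
  have hc : c = 0 := by
    -- Flat inner product with ν, which kills the tangents.
    have : c * (1 + a₁ ^ 2 + a₂ ^ 2) = 0 := by linear_combination -a₁ * e0 - a₂ * e1 + e2
    exact (mul_eq_zero.1 this).resolve_right hW
  subst hc
  refine ⟨rfl, fun i => ?_⟩
  field_simp at e0 e1
  fin_cases i
  -- The coefficients are the rows of `planeGram`, which undo its inverse.
  · have : d₀ * u 0 * (1 + a₁ ^ 2 + a₂ ^ 2) = 0 := by
      linear_combination -(1 + a₁ ^ 2) * e0 - a₁ * a₂ * e1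
    exact (mul_eq_zero.1 this).resolve_right hW
  · have : d₀ * u 1 * (1 + a₁ ^ 2 + a₂ ^ 2) = 0 := by
      linear_combination -(1 + a₂ ^ 2) * e1 - a₁ * a₂ * e0
    exact (mul_eq_zero.1 this).resolve_right hW

include hG h0 in
/-- Proper biharmonicity of the plane, for the metric whose tension field is `G u` times the
normal vector. -/
theorem isProperBiharmonicMap_planeMap_iff {ρ u : (Fin 2 → ℝ) → ℝ} (hρ : ∀ p, ρ p ≠ 0)
    (hu : ContDiff ℝ ∞ u)
    (ht : tension (rescale ρ fun _ => planeGram a₁ a₂) (conformalMetric G) (planeMap a₁ a₂ a₃)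
      = fun p => (G (planeMap a₁ a₂ a₃ p) * u p) • planeNormal a₁ a₂)
    (hN : ∀ p, normalDeriv a₁ a₂ G (planeMap a₁ a₂ a₃ p) = 0 ↔ u p = 0) :
    IsProperBiharmonicMap (rescale ρ fun _ => planeGram a₁ a₂) (conformalMetric G)
        (planeMap a₁ a₂ a₃) ↔
      (∀ p, planeOperator a₁ a₂ G (planeMap a₁ a₂ a₃ p) = 0) ∧
        ∃ c : ℝ, 0 < c ∧ ∀ p, |u p| = c := by
  have hG0 (p) := (h0 (planeMap a₁ a₂ a₃ p)).ne'
  have hn : planeNormal a₁ a₂ ≠ 0 := fun h => by simpa [planeNormal] using congrFun h 2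
  have hconst (hne : ∀ p, u p ≠ 0) (h : ∀ i p, u p * pd i u p = 0) :
      ∀ i j p, pd i (pd j u) p = 0 := fun i j p => by
    have : pd j u = fun _ => 0 := funext fun q => (mul_eq_zero.1 (h j q)).resolve_left (hne q)
    rw [this, pd_const]
  constructor
  · rintro ⟨hb, hh⟩
    have key (p) := by
      have h := hb p
      rw [bitension_planeMap hG h0 hρ hu ht] at h
      exact smul_planeNormal_sub_eq_zero _ ((smul_eq_zero.1 h).resolve_left (inv_ne_zero (hρ p)))
    -- The tangential equation gives N ∂ᵢu = 0; N may be traded for u because their zeros agree.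
    have hm (i p) : u p * pd i u p = 0 := by
      have := (key p).2 i
      rw [mul_eq_zero, mul_eq_zero_iff_left two_ne_zero, hN] at this
      exact mul_eq_zero.2 this
    have hsq := eq_of_mul_pd_eq_zero hu hm
    have habs (p q) : |u p| = |u q| := abs_eq_abs.2 (mul_self_eq_mul_self_iff.1 (hsq p q))
    obtain ⟨p₀, hp₀⟩ : ∃ p, u p ≠ 0 := by
      by_contra! h
      exact hh fun p => by simp [ht, h p]
    have hne (p) : u p ≠ 0 := abs_ne_zero.1 (habs p p₀ ▸ abs_ne_zero.2 hp₀)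
    refine ⟨fun p => ?_, |u p₀|, abs_pos.2 hp₀, fun p => habs p p₀⟩
    have h := (key p).1
    simpa [hconst hne hm, hne, hG0 p] using h
  · rintro ⟨hp, c, hc, hcu⟩
    have hne (p) : u p ≠ 0 := abs_pos.1 (hcu p ▸ hc)
    have hpd (i p) : pd i u p = 0 := by
      have hd : DifferentiableAt ℝ u p := hu.differentiable (by simp) p
      -- Differentiating u² = c² avoids having to show that u keeps one sign.
      have e : (fun p => u p * u p) = fun _ => c * c :=
        funext fun p => by rw [← abs_mul_abs_self, hcu]
      have h := pd_mul i hd hd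
      rw [e, pd_const, mul_comm (u p), ← two_mul] at h
      simpa [hne p] using h.symm
    refine ⟨fun p => ?_, fun h => ?_⟩
    · rw [bitension_planeMap hG h0 hρ hu ht]
      simp [hp, hpd, hconst hne (fun i p => by rw [hpd, mul_zero])]
    · have := h 0
      simp [ht, hne, hn, hG0] at this

end

end

end CoordGeom


/-! ### Assembly: the given metrics, the formula for f and the mean curvature. -/

open CoordGeom in
theorem mainTheorem4 (a₁ a₂ a₃ : ℝ) (F β : (Fin 3 → ℝ) → ℝ) (f : (Fin 2 → ℝ) → ℝ)
    (hF : ContDiff ℝ ∞ F) (hβ : ContDiff ℝ ∞ β) (hf : ContDiff ℝ ∞ f)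
    (hF_pos : ∀ q, 0 < F q) (hβ_pos : ∀ q, 0 < β q) (hf_pos : ∀ p, 0 < f p)
    (φ : (Fin 2 → ℝ) → (Fin 3 → ℝ)) (hφ : φ = CoordGeom.planeMap a₁ a₂ a₃)
    (h₀ h : CoordGeom.MetricField 3)
    (hh₀ : h₀ = CoordGeom.rescale (fun q => (F q ^ 2)⁻¹) (CoordGeom.euclideanMetric 3))
    (hh : h = CoordGeom.rescale (fun q => (β q ^ 2)⁻¹) h₀)
    (g : CoordGeom.MetricField 2)
    (hg : g = CoordGeom.rescale (fun p => (f p)⁻¹) (CoordGeom.pullback φ h))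
    (G : (Fin 3 → ℝ) → ℝ) (hG : G = fun q => F q * β q)
    (ξ : (Fin 2 → ℝ) → (Fin 3 → ℝ))
    (hξ : ξ = fun p => (G (φ p) / √(1 + a₁ ^ 2 + a₂ ^ 2)) • ![-a₁, -a₂, 1]) :
    -- characterization of proper biharmonicity
    (CoordGeom.IsProperBiharmonicMap g h φ ↔
      (∀ p, CoordGeom.planeOperator a₁ a₂ G (φ p) = 0) ∧
      ∃ c : ℝ, 0 < c ∧ ∀ p, CoordGeom.normalDeriv a₁ a₂ G (φ p) ≠ 0 ∧
        f p = c * √(1 + a₁ ^ 2 + a₂ ^ 2) / |CoordGeom.normalDeriv a₁ a₂ G (φ p)|) ∧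
    -- the conformal factor
    CoordGeom.IsConformalImmersion g h φ (fun p => √(f p)) ∧
    -- the mean curvature of the surface
    CoordGeom.IsUnitNormal h φ ξ ∧
    (∀ p, CoordGeom.meanCurvature h φ ξ p =
      CoordGeom.normalDeriv a₁ a₂ G (φ p) / √(1 + a₁ ^ 2 + a₂ ^ 2)) ∧
    (∀ p, CoordGeom.meanCurvatureVector h φ p = CoordGeom.meanCurvature h φ ξ p • ξ p) := by
  have hGs : ContDiff ℝ ∞ G := hG ▸ hF.mul hβ
  have h0 (q) : 0 < G q := by rw [hG]; exact mul_pos (hF_pos q) (hβ_pos q)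
  obtain rfl : h = conformalMetric G := by
    rw [hh, hh₀, hG]
    ext q i j
    simp only [conformalMetric, rescale, smul_smul, mul_pow, mul_inv, mul_comm]
  clear hG
  subst hφ
  set W := 1 + a₁ ^ 2 + a₂ ^ 2 with hW
  have hW0 : 0 < W := planeNorm_pos a₁ a₂
  have hs : √W * √W = W := Real.mul_self_sqrt hW0.le
  have hs0 : √W ≠ 0 := (Real.sqrt_pos.2 hW0).ne'
  have hG0 (p) := (h0 (planeMap a₁ a₂ a₃ p)).ne'
  have hGφ : ContDiff ℝ ∞ fun p => G (planeMap a₁ a₂ a₃ p) := hGs.comp (contDiff_planeMap a₁ a₂ a₃)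
  have hNφ : ContDiff ℝ ∞ fun p => normalDeriv a₁ a₂ G (planeMap a₁ a₂ a₃ p) :=
    (contDiff_normalDeriv hGs).comp (contDiff_planeMap a₁ a₂ a₃)
  have hpb := pullback_conformalMetric a₁ a₂ a₃ G
  have hmv (p) : meanCurvatureVector (conformalMetric G) (planeMap a₁ a₂ a₃) p
      = (normalDeriv a₁ a₂ G (planeMap a₁ a₂ a₃ p) * G (planeMap a₁ a₂ a₃ p) / W)
        • planeNormal a₁ a₂ := by
    rw [meanCurvatureVector, hpb, tension_planeMap hGs h0 (by simp [hG0 p]), smul_smul]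
    congr 1
    have := hG0 p
    rw [← hW]
    field_simp
    simp
  have hmc (p) : meanCurvature (conformalMetric G) (planeMap a₁ a₂ a₃) ξ p
      = normalDeriv a₁ a₂ G (planeMap a₁ a₂ a₃ p) / √W := by
    have := hG0 p
    simp only [meanCurvature, hmv, hξ, metricInner, conformalMetric_apply]
    simp [Fin.sum_univ_three, planeNormal]
    field_simp
    rw [hW]
    ring
  -- The domain metric is f⁻¹ times the pullback G⁻² `planeGram`.
  obtain ⟨ρ, hρ⟩ : ∃ ρ : (Fin 2 → ℝ) → ℝ,
    ρ = fun p => (f p * G (planeMap a₁ a₂ a₃ p) ^ 2)⁻¹ := ⟨_, rfl⟩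
  have hρ0 (p) : 0 < ρ p := by
    rw [hρ]; exact inv_pos.2 (mul_pos (hf_pos p) (pow_pos (h0 _) 2))
  have hρs : ContDiff ℝ ∞ ρ := by
    rw [hρ]
    exact (hf.mul (hGφ.pow 2)).inv fun p => (mul_pos (hf_pos p) (pow_pos (h0 _) 2)).ne'
  obtain rfl : g = rescale ρ fun _ => planeGram a₁ a₂ := by
    rw [hg, hpb, hρ]
    ext p i j
    simp only [rescale, smul_smul, mul_inv]
  refine ⟨?_, ⟨isRiemannianMetric_rescale_planeGram hρs hρ0,
    isRiemannianMetric_conformalMetric hGs h0, contDiff_planeMap a₁ a₂ a₃,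
    injective_fderiv_planeMap, fun p => Real.sqrt_pos.2 (hf_pos p), ?_⟩, ⟨?_, fun p => ⟨?_, ?_⟩⟩,
    hmc, fun p => ?_⟩
  -- This u makes G u ν equal to 2 f H ξ, so |u| is constant exactly when f |H| is.
  · rw [isProperBiharmonicMap_planeMap_iff (G := G)
      (u := fun p => 2 / W * (f p * normalDeriv a₁ a₂ G (planeMap a₁ a₂ a₃ p))) hGs h0
      (fun p => (hρ0 p).ne') (contDiff_const.mul (hf.mul hNφ)) ?_ ?_]
    · refine and_congr_right fun _ => ?_
      have e (p) : |2 / W * (f p * normalDeriv a₁ a₂ G (planeMap a₁ a₂ a₃ p))|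
          = 2 / W * (f p * |normalDeriv a₁ a₂ G (planeMap a₁ a₂ a₃ p)|) := by
        rw [abs_mul, abs_mul, abs_of_pos (hf_pos p), abs_of_pos (by positivity)]
      simp only [e]
      constructor
      · rintro ⟨c, hc, h⟩
        -- From 2 f |N| / W = c one gets f |N| = c W / 2 = (c √W / 2) √W.
        refine ⟨c * √W / 2, by positivity, fun p => ?_⟩
        have hN : normalDeriv a₁ a₂ G (planeMap a₁ a₂ a₃ p) ≠ 0 := fun hN => by
          have := h p
          simp [hN] at this
          exact hc.ne this
        refine ⟨hN, ?_⟩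
        rw [eq_div_iff (abs_ne_zero.2 hN), ← h p]
        field_simp
        rw [pow_two, hs]
      · rintro ⟨c, hc, h⟩
        refine ⟨2 / W * (c * √W), by positivity, fun p => ?_⟩
        rw [(h p).2, div_mul_cancel₀ _ (abs_ne_zero.2 (h p).1)]
    · ext1 p
      rw [tension_planeMap hGs h0 (hρ0 p).ne', hρ]
      congr 1
      have := hG0 p
      have := (hf_pos p).ne'
      rw [← hW]
      field_simp
    · intro p
      simp [(hf_pos p).ne', hW0.ne']
  · rw [hpb, hρ]
    ext p i j
    have := (hf_pos p).ne'
    have := hG0 p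
    simp only [rescale, smul_smul, Real.sq_sqrt (hf_pos p).le]
    field_simp
  · rw [hξ]
    exact (hGφ.div_const _).smul contDiff_const
  · have := hG0 p
    simp only [hξ, metricInner, conformalMetric_apply]
    simp [Fin.sum_univ_three]
    field_simp
    rw [pow_two √W, hs, hW]
    ring
  · intro i
    simp only [hξ, metricInner, conformalMetric_apply, dmap_planeMap]
    fin_cases i <;> simp [Fin.sum_univ_three, planeTangent] <;> ring
  · rw [hmc, hmv, hξ, smul_smul]
    change _ = _ • planeNormal a₁ a₂
    congr 1
    field_simp
    rw [pow_two, hs]
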